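/- Let $s,k,r,n,m\ge 0$ be integers with $k\le s$. For a field $K$, a form is a $K$-linear map $\Psi:\bigwedge^s K^n\to K^m$. The $k$-nullity $\mathrm{null}_k(\Psi)$ is the maximum of the dimensions of linear subspaces $W\subset K^n$ such that $\Psi(w_1\wedge\dots\wedge w_k\wedge v_{k+1}\wedge\dots\wedge v_s)=0$ for all $w_1,\dots,w_k\in W$ and $v_{k+1},\dots,v_s\in K^n$. (Such a $W$ exists whenever $k\ge 1$; if $k=0$ and $\Psi\neq 0$ there is none, and we put $\mathrm{null}_0(\Psi)=0$.) The space $(\bigwedge^s K^n)^*\otimes K^m$ of all forms is given the coordinates $\Psi(e_{i_1}\wedge\dots\wedge e_{i_s})_j$, $1\le i_1<\dots<i_s\le n$, $1\le j\le m$, with $e_1,\dots,e_n$ the standard basis of $K^n$. 1. If $K$ is an algebraically closed field, then the set of forms $\Psi:\bigwedge^s K^n\to K^m$ with $\mathrm{null}_k(\Psi)\ge r$ is a closed algebraic subset of $(\bigwedge^s K^n)^*\otimes K^m$ defined by homogeneous polynomials; that is, it is the set of common zeros of finitely many homogeneous polynomials over $K$ in the coordinates of $\Psi$. 2. Let $K$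 be an arbitrary field with algebraic closure $\overline K$, and for a form $\Psi$ over $K$ let $\overline\Psi:\bigwedge^s\overline K^n\to\overline K^m$ be its extension of scalars. Then the set of forms $\Psi:\bigwedge^s K^n\to K^m$ with $\mathrm{null}_k(\overline\Psi)\ge r$ is a closed algebraic subset of $(\bigwedge^s K^n)^*\otimes K^m$ defined by finitely many homogeneous polynomials with coefficients in $K$. (Nonzero constants count as homogeneous polynomials of degree $0$; they are needed when the set is empty, that is, when $r>n$.) -/

import Mathlib

/-- A skew-symmetric (alternating) `s`-form on `K ^ n` with values in `K ^ m`, that is, a linear map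
`⋀ ^ s K ^ n → K ^ m`. -/
abbrev SkewForm (K : Type*) [Field K] (s n m : ℕ) : Type _ :=
  (⋀[K]^s (Fin n → K)) →ₗ[K] (Fin m → K)

namespace SkewForm

/-- The standard basis `e_{i_1} ∧ … ∧ e_{i_s}`, `i_1 < … < i_s`, of `⋀ ^ s K ^ n`; it is indexed by
the `s`-element subsets of `Fin n`. -/
noncomputable def wedgeBasis (K : Type*) [Field K] (s n : ℕ) :
    Module.Basis (Set.powersetCard (Fin n) s) K (⋀[K]^s (Fin n → K)) :=
  (Pi.basisFun K (Fin n)).exteriorPower s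

/-- `Ψ` vanishes whenever its first `k` arguments are taken from `W`, the remaining `s - k`
arguments being arbitrary: `Ψ(W, …, W, K ^ n, …, K ^ n) = 0`. -/
def VanishesOn {K : Type*} [Field K] {s n m : ℕ} (k : ℕ) (Ψ : SkewForm K s n m)
    (W : Submodule K (Fin n → K)) : Prop :=
  ∀ v : Fin s → Fin n → K, (∀ i : Fin s, (i : ℕ) < k → v i ∈ W) →
    Ψ (exteriorPower.ιMulti K s v) = 0

/-- The `k`-nullity of `Ψ`: the largest dimension of a subspace `W` of `K ^ n` such that
`Ψ(W, …, W, K ^ n, …, K ^ n) = 0` with `k` arguments `W`. The dimensions are bounded by `n`, and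
for `1 ≤ k ≤ s` the subspace `0` is admissible, so this is a genuine maximum; for `k = 0` and
`Ψ ≠ 0` no subspace is admissible and the value is `0`. -/
noncomputable def nullity {K : Type*} [Field K] {s n m : ℕ} (k : ℕ) (Ψ : SkewForm K s n m) : ℕ :=
  sSup {d : ℕ | ∃ W : Submodule K (Fin n → K), VanishesOn k Ψ W ∧ Module.finrank K W = d}

/-- The coordinates of a form in the space `(⋀ ^ s K ^ n)^* ⊗ K ^ m` of all forms, with respect to
the standard bases: the `(I, j)`-coordinate of `Ψ` is the `j`-th entry of `Ψ(e_I)`. -/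
noncomputable def coords {K : Type*} [Field K] {s n m : ℕ} (Ψ : SkewForm K s n m) :
    Set.powersetCard (Fin n) s × Fin m → K :=
  fun p => Ψ (wedgeBasis K s n p.1) p.2

/-- A set of forms is a closed algebraic subset defined by homogeneous polynomials with
coefficients in `K` if it is the set of common zeros, in the space of all forms over `K`, of finitely
many homogeneous polynomials over `K` in the coordinates of a form. -/
def IsHomogeneousAlgebraicSet {K : Type*} [Field K] {s n m : ℕ} (Z : Set (SkewForm K s n m)) :
    Prop :=
  ∃ S : Finset (MvPolynomial (Set.powersetCard (Fin n) s × Fin m) K),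
    (∀ F ∈ S, ∃ d : ℕ, F.IsHomogeneous d) ∧
      ∀ Ψ : SkewForm K s n m, Ψ ∈ Z ↔ ∀ F ∈ S, MvPolynomial.eval (coords Ψ) F = 0

/-- The extension of `Ψ : ⋀ ^ s K ^ n → K ^ m` to an extension field `L` of `K`: the `L`-linear map
`⋀ ^ s L ^ n → L ^ m` with the same values as `Ψ` on the standard basis vectors. -/
noncomputable def extendScalars {K : Type*} [Field K] {s n m : ℕ} (L : Type*) [Field L]
    [Algebra K L] (Ψ : SkewForm K s n m) : SkewForm L s n m :=
  (wedgeBasis L s n).constr L fun I j => algebraMap K L (Ψ (wedgeBasis K s n I) j)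

/-- The extended form agrees with `Ψ` on wedges of vectors with entries in `K`. -/
theorem extendScalars_iMulti {K : Type*} [Field K] {s n m : ℕ} (L : Type*) [Field L] [Algebra K L]
  (Ψ : SkewForm K s n m) (v : Fin s → Fin n → K) (j : Fin m) :
  extendScalars L Ψ (exteriorPower.ιMulti L s fun i a => algebraMap K L (v i a)) j
   = algebraMap K L (Ψ (exteriorPower.ιMulti K s v) j) := by
  have key : (exteriorPower.ιMulti L s fun i a => algebraMap K L (v i a)) =
     ∑ I, algebraMap K L ((wedgeBasis K s n).repr (exteriorPower.ιMulti K s v) I) • wedgeBasis L s n I := by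
    rw [← (wedgeBasis L s n).sum_repr (exteriorPower.ιMulti L s _)]
    refine Finset.sum_congr rfl fun I _ => ?_
    congr 1
    simp only [wedgeBasis, exteriorPower.basis_repr_apply, exteriorPower.ιMultiDual_apply_ιMulti]
    rw [RingHom.map_det]
    congr 1
  rw [key]
  conv_rhs => rw [← (wedgeBasis K s n).sum_repr (exteriorPower.ιMulti K s v)]
  simp only [extendScalars, map_sum, map_smul, Module.Basis.constr_basis, Finset.sum_apply,
    Pi.smul_apply, smul_eq_mul, map_mul]

end SkewForm

/-! The set is the projection of a closed set from a product with a projective space. The nullity is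
at least `r + 1` exactly when the form vanishes on the contractions of some nonzero alternating
tensor `y` of order `r + 1` (`succ_le_nullity_iff_exists_tensor`). From an admissible `W`, wedge `r
+ 1` independent vectors of `W`: the contractions stay in `W`. Conversely, contractions of any such
`y` span dimension at least `r + 1`, so decomposability of `y`, and with it the Plücker relations,
is not needed.

These conditions are homogeneous in `y` and, separately, in the coordinates of the form, so
elimination theory applies. By the Nullstellensatz, there is no nonzero common zero over `L` iff the
ideal contains all monomials of some degree `d`, iff the degree `d` monomial multiples of the
equations span, iff some square Macaulay determinant is nonzero. These determinants have
coefficients in `K`, which gives the second claim; the first is `L = K`. -/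

/-! ### Elimination theory by Macaulay determinants -/

namespace MvPolynomial

/-- The exponent vectors of total degree `d` in finitely many variables. -/
abbrev ExponentsOfDegree (τ : Type*) [Fintype τ] [DecidableEq τ] (d : ℕ) : Type _ :=
  (Finset.univ : Finset τ).finsuppAntidiag d

theorem mem_finsuppAntidiag_univ_iff {τ : Type*} [Fintype τ] [DecidableEq τ] {d : ℕ} {b : τ →₀ ℕ} :
    b ∈ (Finset.univ : Finset τ).finsuppAntidiag d ↔ b.degree = d := by
  simp [Finset.mem_finsuppAntidiag, Finsupp.degree_eq_sum]

/-- The pairs consisting of a member of a family of polynomials of degrees `D i` and an exponent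
vector, such that the product of the polynomial and of the monomial has degree `d`. -/
abbrev MonomialMultiples {ι : Type*} (D : ι → ℕ) (τ : Type*) (d : ℕ) : Type _ :=
  {q : ι × (τ →₀ ℕ) // q.2.degree + D q.1 = d}

/-- The coefficients, in degree `d`, of a tuple of monomial multiples of the polynomials `F i`. -/
noncomputable def macaulayMatrix {ι τ R : Type*} [Fintype τ] [DecidableEq τ] [CommRing R]
    (F : ι → MvPolynomial τ R) {D : ι → ℕ} {d : ℕ}
    (c : ExponentsOfDegree τ d → MonomialMultiples D τ d) :
    Matrix (ExponentsOfDegree τ d) (ExponentsOfDegree τ d) R :=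
  Matrix.of fun b b' => coeff b (monomial (c b').1.2 1 * F (c b').1.1)

section Field

variable {ι τ K L : Type*} [Fintype τ] [DecidableEq τ] [Field K] [Field L] [Algebra K L]

theorem aeval_eq_sum_exponentsOfDegree {d : ℕ} {p : MvPolynomial τ K} (hp : p.IsHomogeneous d)
    (y : τ → L) :
    aeval y p = ∑ b : ExponentsOfDegree τ d,
      algebraMap K L (coeff b p) * ∏ t, y t ^ (b : τ →₀ ℕ) t := by
  rw [aeval_def, eval₂_eq', Finset.sum_coe_sort ((Finset.univ : Finset τ).finsuppAntidiag d)
    fun b => algebraMap K L (coeff b p) * ∏ t, y t ^ b t]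
  refine Finset.sum_subset (fun b hb => ?_) fun b _ hb => ?_
  · rw [mem_finsuppAntidiag_univ_iff]
    by_contra h
    exact (mem_support_iff.1 hb) (hp.coeff_eq_zero h)
  · rw [notMem_support_iff.1 hb, map_zero, zero_mul]

/-- The row vector of degree `d` monomials evaluated at `y` kills every column, since the product is
the value at `y` of a multiple of some `f i`. -/
theorem det_macaulayMatrix_eq_zero {f : ι → MvPolynomial τ K} {D : ι → ℕ}
    (hf : ∀ i, (f i).IsHomogeneous (D i)) {y : τ → L} (hy : y ≠ 0) (hfy : ∀ i, aeval y (f i) = 0)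
    {d : ℕ} (c : ExponentsOfDegree τ d → MonomialMultiples D τ d) :
    (macaulayMatrix f c).det = 0 := by
  obtain ⟨t, ht⟩ := Function.ne_iff.1 hy
  have key : ((macaulayMatrix f c).map (algebraMap K L)).det = 0 := by
    rw [← Matrix.exists_vecMul_eq_zero_iff]
    refine ⟨fun b => ∏ t, y t ^ (b : τ →₀ ℕ) t, fun h => ?_, ?_⟩
    -- The pure power `y t ^ d` is a nonzero entry of this vector.
    · have h0 := congrFun h ⟨Finsupp.single t d, mem_finsuppAntidiag_univ_iff.2 (by simp)⟩
      simp only [Pi.zero_apply, Finset.prod_eq_zero_iff, Finset.mem_univ, true_and] at h0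
      obtain ⟨u, hu⟩ := h0
      by_cases hut : t = u
      · subst hut
        exact ht (by simpa using eq_zero_of_pow_eq_zero hu)
      · rw [Finsupp.single_eq_of_ne (Ne.symm hut), pow_zero] at hu
        exact one_ne_zero hu
    · funext b'
      have hom : (monomial (c b').1.2 (1 : K) * f (c b').1.1).IsHomogeneous d := by
        have hmul := (isHomogeneous_monomial (1 : K) (rfl : (c b').1.2.degree = _)).mul
          (hf (c b').1.1)
        rwa [(c b').2] at hmul
      have := aeval_eq_sum_exponentsOfDegree hom y
      rw [map_mul, hfy, mul_zero] at this
      rw [Pi.zero_apply, this]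
      refine Finset.sum_congr rfl fun b _ => ?_
      rw [mul_comm]
      rfl
  rw [← RingHom.mapMatrix_apply, ← RingHom.map_det] at key
  exact (map_eq_zero_iff _ (algebraMap K L).injective).1 key

theorem span_coeff_eq_top {f : ι → MvPolynomial τ K} {D : ι → ℕ}
    (hf : ∀ i, (f i).IsHomogeneous (D i)) {d : ℕ}
    (hd : idealOfVars τ K ^ d ≤ Ideal.span (Set.range f)) :
    Submodule.span K (Set.range fun (q : MonomialMultiples D τ d) (b : ExponentsOfDegree τ d) =>
      coeff b (monomial q.1.2 1 * f q.1.1)) = ⊤ := by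
  set V := Submodule.span K (Set.range fun (q : MonomialMultiples D τ d)
    (b : ExponentsOfDegree τ d) => coeff b (monomial q.1.2 1 * f q.1.1))
  let φ : MvPolynomial τ K →ₗ[K] (ExponentsOfDegree τ d → K) :=
    LinearMap.pi fun b => lcoeff K (b : τ →₀ ℕ)
  have hmono : ∀ (a : τ →₀ ℕ) (r : K) (i : ι), φ (monomial a r * f i) ∈ V := fun a r i => by
    have hr : monomial a r * f i = r • (monomial a 1 * f i) := by
      rw [← smul_mul_assoc, smul_monomial, smul_eq_mul, mul_one]
    rw [hr, map_smul]
    refine V.smul_mem _ ?_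
    by_cases h : a.degree + D i = d
    · exact Submodule.subset_span ⟨⟨(a, i).swap, h⟩, rfl⟩
    · convert V.zero_mem
      funext b
      refine ((isHomogeneous_monomial (1 : K) rfl).mul (hf i)).coeff_eq_zero fun hb => h ?_
      rw [← hb, mem_finsuppAntidiag_univ_iff.1 b.2]
  have hideal : ∀ p ∈ Ideal.span (Set.range f), φ p ∈ V := fun p hp => by
    induction hp using Submodule.span_induction with
    | mem p hp =>
      obtain ⟨i, rfl⟩ := hp
      simpa using hmono 0 1 i
    | zero => simp
    | add p q _ _ hp hq => rw [map_add]; exact V.add_mem hp hq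
    | smul g p hp _ =>
      -- `V` is only `K`-linear, so the multiplier `g` must be quantified inside a second induction.
      refine Submodule.span_induction ?_ ?_ ?_ ?_ hp (p := fun p _ => ∀ g, φ (g • p) ∈ V) g
      · rintro _ ⟨i, rfl⟩ g
        induction g using MvPolynomial.induction_on' with
        | monomial a r => exact hmono a r i
        | add g g' hg hg' => rw [add_smul, map_add]; exact V.add_mem hg hg'
      · simp
      · intro p q _ _ hp hq g
        rw [smul_add, map_add]
        exact V.add_mem (hp g) (hq g)
      · intro g' p _ hp g
        rw [smul_smul]
        exact hp _
  rw [eq_top_iff, ← (Pi.basisFun K (ExponentsOfDegree τ d)).span_eq, Submodule.span_le]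
  rintro _ ⟨b, rfl⟩
  have := hideal _ (hd ((monomial_mem_pow_idealOfVars_iff d (b : τ →₀ ℕ) (one_ne_zero (α := K))).2
    (mem_finsuppAntidiag_univ_iff.1 b.2).ge))
  have hb : Pi.basisFun K (ExponentsOfDegree τ d) b = φ (monomial b 1) := by
    funext b'
    simp only [φ, Pi.basisFun_apply, Pi.single_apply, LinearMap.pi_apply, lcoeff_apply,
      coeff_monomial, Subtype.ext_iff]
    exact if_congr eq_comm rfl rfl
  rw [hb]
  exact this

theorem exists_det_macaulayMatrix_ne_zero {f : ι → MvPolynomial τ K} {D : ι → ℕ}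
    (hf : ∀ i, (f i).IsHomogeneous (D i)) {d : ℕ}
    (hd : idealOfVars τ K ^ d ≤ Ideal.span (Set.range f)) :
    ∃ c : ExponentsOfDegree τ d → MonomialMultiples D τ d, (macaulayMatrix f c).det ≠ 0 := by
  obtain ⟨κ, a, -, hspan, hli⟩ := exists_linearIndependent' K
    (fun (q : MonomialMultiples D τ d) (b : ExponentsOfDegree τ d) =>
      coeff b (monomial q.1.2 1 * f q.1.1))
  rw [span_coeff_eq_top hf hd] at hspan
  let e := (Pi.basisFun K (ExponentsOfDegree τ d)).indexEquiv (Module.Basis.mk hli hspan.ge)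
  refine ⟨a ∘ e, ?_⟩
  have hcol := hli.comp e e.injective
  have := (Matrix.linearIndependent_cols_iff_isUnit (A := macaulayMatrix f (a ∘ e))).1 hcol
  exact ((Matrix.isUnit_iff_isUnit_det _).1 this).ne_zero

/-- Homogeneous polynomials over `K` have a common nonzero zero over the algebraically closed
extension `L` if and only if all their Macaulay determinants vanish. -/
theorem exists_ne_zero_aeval_eq_zero_iff [IsAlgClosed L] {f : ι → MvPolynomial τ K} {D : ι → ℕ}
    (hf : ∀ i, (f i).IsHomogeneous (D i)) :
    (∃ y : τ → L, y ≠ 0 ∧ ∀ i, aeval y (f i) = 0) ↔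
      ∀ (d : ℕ) (c : ExponentsOfDegree τ d → MonomialMultiples D τ d),
        (macaulayMatrix f c).det = 0 := by
  refine ⟨fun ⟨y, hy, hfy⟩ d c => det_macaulayMatrix_eq_zero hf hy hfy c, fun h => ?_⟩
  by_contra! hno
  have hrad : idealOfVars τ K ≤ (Ideal.span (Set.range f)).radical := by
    rw [← vanishingIdeal_zeroLocus_eq_radical (K := L), zeroLocus_span]
    refine Ideal.span_le.2 ?_
    rintro _ ⟨t, rfl⟩ y hy
    by_cases h0 : y = 0
    · simp [h0]
    · obtain ⟨i, hi⟩ := hno y h0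
      exact absurd (hy _ ⟨i, rfl⟩) hi
  obtain ⟨d, hd⟩ := Ideal.exists_pow_le_of_le_radical_of_fg hrad (idealOfVars_fg τ K)
  obtain ⟨c, hc⟩ := exists_det_macaulayMatrix_ne_zero hf hd
  exact hc (h d c)

end Field

/-- All entries of one column have the same degree, hence so do all Leibniz terms. -/
theorem isHomogeneous_det_macaulayMatrix {ι σ τ K : Type*} [Fintype τ] [DecidableEq τ] [Field K]
    {F : ι → MvPolynomial τ (MvPolynomial σ K)} {D E : ι → ℕ}
    (hE : ∀ i b, (coeff b (F i)).IsHomogeneous (E i)) {d : ℕ}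
    (c : ExponentsOfDegree τ d → MonomialMultiples D τ d) :
    (macaulayMatrix F c).det.IsHomogeneous (∑ b, E (c b).1.1) := by
  rw [Matrix.det_apply]
  refine IsHomogeneous.sum _ _ _ fun π _ => ?_
  have hprod : (∏ b, macaulayMatrix F c (π b) b).IsHomogeneous (∑ b, E (c b).1.1) := by
    refine IsHomogeneous.prod _ _ _ fun b _ => ?_
    rw [macaulayMatrix, Matrix.of_apply, coeff_monomial_mul']
    split_ifs
    · rw [one_mul]
      exact hE _ _
    · exact isHomogeneous_zero _ _ _
  rcases Int.units_eq_one_or (Equiv.Perm.sign π) with h | h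
  · rwa [h, one_smul]
  · rw [h, Units.neg_smul, one_smul]
    exact hprod.neg

theorem det_macaulayMatrix_map {ι σ τ K : Type*} [Fintype τ] [DecidableEq τ] [Field K]
    (F : ι → MvPolynomial τ (MvPolynomial σ K)) {D : ι → ℕ} {d : ℕ}
    (c : ExponentsOfDegree τ d → MonomialMultiples D τ d) (a : σ → K) :
    (macaulayMatrix (fun i => map (eval a) (F i)) c).det = eval a (macaulayMatrix F c).det := by
  rw [RingHom.map_det]
  congr 1
  ext b b'
  simp [macaulayMatrix, ← coeff_map]

/-- The main theorem of elimination theory, with homogeneous parameters: if the `F i` are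
homogeneous in the variables `τ` and in the parameters `σ`, then the parameters over `K` for which
they have a common nonzero zero over the algebraically closed extension `L` are the common zeros of
finitely many homogeneous polynomials over `K`. -/
theorem exists_finset_isHomogeneous_forall_eval_eq_zero_iff {ι σ τ K : Type*} (L : Type*) [Finite σ]
    [Finite τ] [Field K] [Field L] [Algebra K L] [IsAlgClosed L]
    {F : ι → MvPolynomial τ (MvPolynomial σ K)} {D E : ι → ℕ} (hD : ∀ i, (F i).IsHomogeneous (D i))
    (hE : ∀ i b, (coeff b (F i)).IsHomogeneous (E i)) :
    ∃ S : Finset (MvPolynomial σ K), (∀ G ∈ S, ∃ d, G.IsHomogeneous d) ∧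
      ∀ a : σ → K, (∃ y : τ → L, y ≠ 0 ∧ ∀ i, aeval y (map (eval a) (F i)) = 0) ↔
        ∀ G ∈ S, eval a G = 0 := by
  classical
  have := Fintype.ofFinite τ
  let T : Set (MvPolynomial σ K) := {G | ∃ (d : ℕ)
    (c : ExponentsOfDegree τ d → MonomialMultiples D τ d), (macaulayMatrix F c).det = G}
  -- Hilbert's basis theorem, with generators chosen among the determinants themselves so that they
  -- are homogeneous.
  obtain ⟨S, hST, hspan⟩ := (Submodule.fg_span_iff_fg_span_finset_subset T).1
    (IsNoetherian.noetherian (Submodule.span (MvPolynomial σ K) T))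
  refine ⟨S, fun G hG => ?_, fun a => ?_⟩
  · obtain ⟨d, c, rfl⟩ := hST hG
    exact ⟨_, isHomogeneous_det_macaulayMatrix hE c⟩
  · rw [exists_ne_zero_aeval_eq_zero_iff fun i => (hD i).map (eval a)]
    simp only [det_macaulayMatrix_map]
    constructor
    · intro h G hG
      obtain ⟨d, c, rfl⟩ := hST hG
      exact h d c
    · intro h d c
      have hle : Ideal.span (S : Set (MvPolynomial σ K)) ≤ RingHom.ker (eval a) :=
        Ideal.span_le.2 h
      refine hle ?_
      change _ ∈ Submodule.span (MvPolynomial σ K) (S : Set (MvPolynomial σ K))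
      rw [← hspan]
      exact Submodule.subset_span ⟨d, c, rfl⟩

end MvPolynomial

/-! ### Alternating tensors and their contractions -/

section AlternatingTensor

variable {ι L : Type*} [Field L] {r : ℕ}

/-- The entries `y i` of an `r`-tensor form an alternating tensor. -/
def IsAlternatingTensor (y : (Fin r → ι) → L) : Prop :=
  (∀ i, ¬ Function.Injective i → y i = 0) ∧
    ∀ i (π : Equiv.Perm (Fin r)), y (i ∘ π) = ((Equiv.Perm.sign π : ℤ) : L) * y i

/-- The vector obtained by fixing all but the first index of a tensor. -/
def tensorContraction (y : (Fin (r + 1) → ι) → L) (J : Fin r → ι) : ι → L :=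
  fun i => y (Fin.cons i J)

/-- The entries of a wedge product of vectors: the maximal minors of the matrix with rows `w`. -/
def wedgeTensor (w : Fin r → ι → L) (i : Fin r → ι) : L :=
  (Matrix.of fun a b => w a (i b)).det

/-- Deleting entry `q` of `i` and putting `i p` in front permutes `i` if `p = q` and repeats an
index otherwise. So, where `y i` is nonzero, these contractions are independent. -/
theorem IsAlternatingTensor.tensorContraction_succAbove {y : (Fin (r + 1) → ι) → L}
    (hy : IsAlternatingTensor y) (i : Fin (r + 1) → ι) (p q : Fin (r + 1)) :
    tensorContraction y (i ∘ q.succAbove) (i p) =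
      if p = q then ((Equiv.Perm.sign q.cycleRange.symm : ℤ) : L) * y i else 0 := by
  split_ifs with h
  · subst h
    rw [← hy.2]
    refine congrArg y (funext fun t => ?_)
    refine Fin.cases ?_ (fun t => ?_) t <;> simp
  · obtain ⟨t, rfl⟩ := Fin.exists_succAbove_eq h
    refine hy.1 _ fun hinj => ?_
    exact Fin.succ_ne_zero t (hinj (by simp))

/-- The contractions of a nonzero alternating tensor span a space of dimension at least its order. -/
theorem IsAlternatingTensor.le_finrank_span_tensorContraction [Finite ι]
    {y : (Fin (r + 1) → ι) → L} (hy : IsAlternatingTensor y) (h0 : y ≠ 0) :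
    r + 1 ≤ Module.finrank L (Submodule.span L (Set.range (tensorContraction y))) := by
  obtain ⟨i, hi⟩ := Function.ne_iff.1 h0
  have hli : LinearIndependent L fun q : Fin (r + 1) =>
      tensorContraction y (i ∘ q.succAbove) := by
    rw [Fintype.linearIndependent_iff]
    intro g hg p
    have hp := congrFun hg (i p)
    simp only [Finset.sum_apply, Pi.smul_apply, hy.tensorContraction_succAbove, smul_eq_mul,
      mul_ite, mul_zero, Finset.sum_ite_eq, Finset.mem_univ, if_true, Pi.zero_apply] at hp
    refine (mul_eq_zero.1 hp).resolve_right (mul_ne_zero ?_ hi)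
    rcases Int.units_eq_one_or (Equiv.Perm.sign p.cycleRange.symm) with h | h <;> simp [h]
  have hcard := finrank_span_eq_card hli
  rw [Fintype.card_fin] at hcard
  rw [← hcard]
  refine Submodule.finrank_mono (Submodule.span_mono ?_)
  rintro _ ⟨q, rfl⟩
  exact ⟨_, rfl⟩

theorem isAlternatingTensor_wedgeTensor (w : Fin r → ι → L) :
    IsAlternatingTensor (wedgeTensor w) := by
  refine ⟨fun i hi => ?_, fun i π => ?_⟩
  · rw [Function.Injective] at hi
    push Not at hi
    obtain ⟨p, q, hpq, hne⟩ := hi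
    exact Matrix.det_zero_of_column_eq (M := Matrix.of fun a b => w a (i b)) hne
      fun a => by simp [hpq]
  · exact Matrix.det_permute' π (Matrix.of fun a b => w a (i b))

/-- Row rank equals column rank, so some `r` columns form an invertible minor. -/
theorem wedgeTensor_ne_zero [Finite ι] {w : Fin r → ι → L} (hw : LinearIndependent L w) :
    wedgeTensor w ≠ 0 := by
  have := Fintype.ofFinite ι
  let A : Matrix (Fin r) ι L := Matrix.of w
  have hrank : A.rank = r := by
    simpa using hw.rank_matrix (M := A)
  have htop : Submodule.span L (Set.range A.col) = ⊤ := by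
    refine Submodule.eq_top_of_finrank_eq ?_
    rw [← Matrix.rank_eq_finrank_span_cols, hrank, Module.finrank_fin_fun]
  obtain ⟨κ, a, -, hspan, hli⟩ := exists_linearIndependent' L A.col
  rw [htop] at hspan
  let e := (Pi.basisFun L (Fin r)).indexEquiv (Module.Basis.mk hli hspan.ge)
  have hcol := hli.comp e e.injective
  have hunit := (Matrix.linearIndependent_cols_iff_isUnit
    (A := Matrix.of fun p b => w p (a (e b)))).1 hcol
  exact fun h => ((Matrix.isUnit_iff_isUnit_det _).1 hunit).ne_zero (congrFun h (a ∘ e))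

theorem tensorContraction_wedgeTensor_mem_span (w : Fin (r + 1) → ι → L) (J : Fin r → ι) :
    tensorContraction (wedgeTensor w) J ∈ Submodule.span L (Set.range w) := by
  have : tensorContraction (wedgeTensor w) J = ∑ p : Fin (r + 1),
      ((-1) ^ (p : ℕ) * (Matrix.of fun a b => w (p.succAbove a) (J b)).det) • w p := by
    funext i
    -- Laplace expansion along the first column, the only one depending on `i`.
    simp only [tensorContraction, wedgeTensor, Matrix.det_succ_column_zero, Finset.sum_apply,
      Pi.smul_apply, smul_eq_mul]
    refine Finset.sum_congr rfl fun p _ => ?_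
    rw [mul_right_comm]
    rfl
  rw [this]
  exact Submodule.sum_mem _ fun p _ => Submodule.smul_mem _ _ (Submodule.subset_span ⟨p, rfl⟩)

end AlternatingTensor

theorem MultilinearMap.map_eq_zero_of_mem_span {R ι κ M N : Type*} [CommSemiring R] [Fintype ι]
    [Finite κ] [AddCommMonoid M] [AddCommMonoid N] [Module R M] [Module R N]
    (f : MultilinearMap R (fun _ : ι => M) N) {z : ι → κ → M}
    (hz : ∀ q : ι → κ, f (fun p => z p (q p)) = 0) {v : ι → M}
    (hv : ∀ p, v p ∈ Submodule.span R (Set.range (z p))) : f v = 0 := by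
  classical
  have := Fintype.ofFinite κ
  choose c hc using fun p => (Submodule.mem_span_range_iff_exists_fun R).1 (hv p)
  rw [← funext hc, f.map_sum]
  refine Finset.sum_eq_zero fun q _ => ?_
  rw [f.map_smul_univ (fun p => c p (q p)), hz, smul_zero]

/-! ### Nullity in terms of alternating tensors -/

namespace SkewForm

variable {K : Type*} [Field K] {s n m : ℕ}

/-- The form as an alternating map on vectors, with one entry of the value selected. -/
noncomputable def entry (Ψ : SkewForm K s n m) (j : Fin m) :
    MultilinearMap K (fun _ : Fin s => Fin n → K) K :=
  (((LinearMap.proj j).comp Ψ).compAlternatingMap (exteriorPower.ιMulti K s)).toMultilinearMap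

theorem entry_apply (Ψ : SkewForm K s n m) (j : Fin m) (v : Fin s → Fin n → K) :
    entry Ψ j v = Ψ (exteriorPower.ιMulti K s v) j := rfl

theorem entry_eq_sum (Ψ : SkewForm K s n m) (j : Fin m) (v : Fin s → Fin n → K) :
    entry Ψ j v = ∑ i : Fin s → Fin n,
      (∏ p, v p (i p)) * entry Ψ j fun p => Pi.single (i p) 1 := by
  conv_lhs => rw [funext fun p => pi_eq_sum_univ' (v p)]
  rw [(entry Ψ j).map_sum]
  refine Finset.sum_congr rfl fun i _ => ?_
  rw [(entry Ψ j).map_smul_univ (fun p => v p (i p)), smul_eq_mul]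

theorem entry_extendScalars (L : Type*) [Field L] [Algebra K L] (Ψ : SkewForm K s n m) (j : Fin m)
    (i : Fin s → Fin n) :
    (entry (extendScalars L Ψ) j fun p => Pi.single (i p) 1) =
      algebraMap K L (entry Ψ j fun p => Pi.single (i p) 1) := by
  have hsingle : (fun p => Pi.single (i p) 1 : Fin s → Fin n → L) =
      fun p a => algebraMap K L ((Pi.single (i p) 1 : Fin n → K) a) := by
    funext p a
    by_cases h : a = i p
    · subst h; simp
    · simp [h]
  rw [entry_apply, entry_apply, ← extendScalars_iMulti, hsingle]

theorem extendScalars_self (Ψ : SkewForm K s n m) : extendScalars K Ψ = Ψ :=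
  (wedgeBasis K s n).ext fun I => by
    rw [extendScalars, Module.Basis.constr_basis]
    rfl

/-- The linear form in the coordinates of a form which gives its value on basis vectors. -/
noncomputable def entryPolynomial (K : Type*) [Field K] {s n m : ℕ} (j : Fin m)
    (i : Fin s → Fin n) : MvPolynomial (Set.powersetCard (Fin n) s × Fin m) K :=
  ∑ I, MvPolynomial.C ((wedgeBasis K s n).repr
    (exteriorPower.ιMulti K s fun p => Pi.single (i p) 1) I) * MvPolynomial.X (I, j)

theorem isHomogeneous_entryPolynomial (j : Fin m) (i : Fin s → Fin n) :
    (entryPolynomial K j i).IsHomogeneous 1 :=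
  MvPolynomial.IsHomogeneous.sum _ _ _ fun _ _ => MvPolynomial.isHomogeneous_C_mul_X _ _

theorem eval_entryPolynomial (Ψ : SkewForm K s n m) (j : Fin m) (i : Fin s → Fin n) :
    MvPolynomial.eval (coords Ψ) (entryPolynomial K j i) =
      entry Ψ j fun p => Pi.single (i p) 1 := by
  rw [entry_apply]
  conv_rhs => rw [← (wedgeBasis K s n).sum_repr (exteriorPower.ιMulti K s _)]
  simp only [entryPolynomial, coords, map_sum, map_mul, MvPolynomial.eval_C, MvPolynomial.eval_X,
    map_smul, Finset.sum_apply, Pi.smul_apply, smul_eq_mul]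

/-- The vanishing of a form on the span of a family of vectors can be tested on that family and on
the standard basis. -/
theorem vanishesOn_span_iff [NeZero n] {κ : Type*} [Finite κ] [Nonempty κ] {k : ℕ}
    {Ψ : SkewForm K s n m} {w : κ → Fin n → K} :
    VanishesOn k Ψ (Submodule.span K (Set.range w)) ↔ ∀ (q : Fin s → κ × Fin n) (j : Fin m),
      (entry Ψ j fun p => if (p : ℕ) < k then w (q p).1 else Pi.single (q p).2 1) = 0 := by
  constructor
  · intro h q j
    rw [entry_apply, h, Pi.zero_apply]
    intro p hp
    rw [if_pos hp]
    exact Submodule.subset_span ⟨_, rfl⟩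
  · intro h v hv
    funext j
    let z : Fin s → κ × Fin n → Fin n → K :=
      fun p x => if (p : ℕ) < k then w x.1 else Pi.single x.2 1
    have hz : ∀ q : Fin s → κ × Fin n, entry Ψ j (fun p => z p (q p)) = 0 := fun q => h q j
    change entry Ψ j v = 0
    refine (entry Ψ j).map_eq_zero_of_mem_span hz fun p => ?_
    by_cases hp : (p : ℕ) < k
    · refine Submodule.span_mono ?_ (hv p hp)
      rintro _ ⟨J, rfl⟩
      -- The component of the pair not used in slot `p` is arbitrary; this needs `n` and `κ`
      -- nonempty.
      exact ⟨(J, 0), by simp [z, hp]⟩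
    · have htop : v p ∈ Submodule.span K (Set.range (Pi.basisFun K (Fin n))) := by
        rw [Module.Basis.span_eq]
        trivial
      refine Submodule.span_mono ?_ htop
      rintro _ ⟨u, rfl⟩
      exact ⟨(Classical.arbitrary κ, u), by simp [z, hp]⟩

theorem VanishesOn.mono {k : ℕ} {Ψ : SkewForm K s n m} {W W' : Submodule K (Fin n → K)}
    (h : VanishesOn k Ψ W') (hW : W ≤ W') : VanishesOn k Ψ W :=
  fun v hv => h v fun i hi => hW (hv i hi)

/-- A positive bound excludes the default value `0` of the supremum of the empty set. -/
theorem succ_le_nullity_iff {k r : ℕ} {Ψ : SkewForm K s n m} :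
    r + 1 ≤ nullity k Ψ ↔ ∃ W, VanishesOn k Ψ W ∧ r + 1 ≤ Module.finrank K W := by
  have hbdd : BddAbove {d : ℕ | ∃ W : Submodule K (Fin n → K),
      VanishesOn k Ψ W ∧ Module.finrank K W = d} := by
    refine ⟨n, ?_⟩
    rintro _ ⟨W, -, rfl⟩
    simpa using W.finrank_le
  constructor
  · intro h
    rcases Set.eq_empty_or_nonempty {d : ℕ | ∃ W : Submodule K (Fin n → K),
      VanishesOn k Ψ W ∧ Module.finrank K W = d} with hempty | hne
    · rw [nullity, hempty, csSup_empty] at h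
      exact absurd h (Nat.not_succ_le_zero r)
    · obtain ⟨W, hW, hd⟩ := Nat.sSup_mem hne hbdd
      exact ⟨W, hW, h.trans hd.ge⟩
  · rintro ⟨W, hW, hr⟩
    exact hr.trans (le_csSup hbdd ⟨W, hW, rfl⟩)

/-- The nullity exceeds `r` if and only if the form vanishes on the contractions of some nonzero
alternating tensor of order `r + 1`. -/
theorem succ_le_nullity_iff_exists_tensor {k r : ℕ} {Ψ : SkewForm K s n m} :
    r + 1 ≤ nullity k Ψ ↔ ∃ y : (Fin (r + 1) → Fin n) → K, y ≠ 0 ∧ IsAlternatingTensor y ∧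
      ∀ (q : Fin s → (Fin r → Fin n) × Fin n) (j : Fin m), (entry Ψ j fun p =>
        if (p : ℕ) < k then tensorContraction y (q p).1 else Pi.single (q p).2 1) = 0 := by
  have hvan : ∀ y : (Fin (r + 1) → Fin n) → K, y ≠ 0 →
      (VanishesOn k Ψ (Submodule.span K (Set.range (tensorContraction y))) ↔
        ∀ (q : Fin s → (Fin r → Fin n) × Fin n) (j : Fin m), (entry Ψ j fun p =>
          if (p : ℕ) < k then tensorContraction y (q p).1 else Pi.single (q p).2 1) = 0) := by
    intro y hy
    obtain ⟨i, -⟩ := Function.ne_iff.1 hy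
    have : NeZero n := ⟨(i 0).pos.ne'⟩
    exact vanishesOn_span_iff
  rw [succ_le_nullity_iff]
  constructor
  · rintro ⟨W, hW, hr⟩
    obtain ⟨w, hw⟩ := exists_linearIndependent_of_le_finrank hr
    have hy := wedgeTensor_ne_zero (hw.map' W.subtype W.ker_subtype)
    refine ⟨_, hy, isAlternatingTensor_wedgeTensor _, (hvan _ hy).1 (hW.mono ?_)⟩
    rw [Submodule.span_le]
    rintro _ ⟨J, rfl⟩
    refine (Submodule.span_le.2 ?_) (tensorContraction_wedgeTensor_mem_span _ J)
    rintro _ ⟨p, rfl⟩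
    exact (w p).2
  · rintro ⟨y, hy, halt, h⟩
    exact ⟨_, (hvan y hy).2 h, halt.le_finrank_span_tensorContraction hy⟩

/-! ### The bihomogeneous equations -/

open MvPolynomial

/-- The entries of the vectors inserted into a form, as polynomials in the entries of a tensor. -/
noncomputable def argumentPolynomial (K : Type*) [Field K] (k : ℕ) {r : ℕ}
    (q : Fin s → (Fin r → Fin n) × Fin n) (i : Fin s → Fin n) (p : Fin s) :
    MvPolynomial (Fin (r + 1) → Fin n) K :=
  if (p : ℕ) < k then X (Fin.cons (i p) (q p).1) else C (if i p = (q p).2 then 1 else 0)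

/-- The equations in the entries of a tensor and in the coordinates of a form which express that the
tensor is alternating and that the form vanishes on its contractions. -/
noncomputable def nullityEquation (K : Type*) [Field K] (s n m k r : ℕ) :
    ((Fin s → (Fin r → Fin n) × Fin n) × Fin m) ⊕
      ({i : Fin (r + 1) → Fin n // ¬ Function.Injective i} ⊕
        ((Fin (r + 1) → Fin n) × Equiv.Perm (Fin (r + 1)))) →
      MvPolynomial (Fin (r + 1) → Fin n) (MvPolynomial (Set.powersetCard (Fin n) s × Fin m) K)
  | .inl (q, j) => ∑ i : Fin s → Fin n,
      C (entryPolynomial K j i) * map C (∏ p, argumentPolynomial K k q i p)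
  | .inr (.inl i) => map C (X i.1)
  | .inr (.inr (i, π)) => map C (X (i ∘ π) - C ((Equiv.Perm.sign π : ℤ) : K) * X i)

/-- The form enters the vanishing conditions linearly and the alternation conditions not at all, so
the degree in its coordinates is `1` or `0`. -/
theorem exists_isHomogeneous_nullityEquation (k r : ℕ) (x) :
    (∃ d, (nullityEquation K s n m k r x).IsHomogeneous d) ∧
      ∃ e, ∀ b, (coeff b (nullityEquation K s n m k r x)).IsHomogeneous e := by
  match x with
  | .inl (q, j) =>
    refine ⟨⟨∑ p : Fin s, if (p : ℕ) < k then 1 else 0, IsHomogeneous.sum _ _ _ fun i _ => ?_⟩,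
      1, fun b => ?_⟩
    · refine IsHomogeneous.C_mul (IsHomogeneous.map ?_ _) _
      refine IsHomogeneous.prod _ _ _ fun p _ => ?_
      rw [argumentPolynomial]
      split_ifs
      exacts [isHomogeneous_X _ _, isHomogeneous_C _ _, isHomogeneous_C _ _]
    · simp only [nullityEquation, coeff_sum, coeff_C_mul, coeff_map]
      refine IsHomogeneous.sum _ _ _ fun i _ => ?_
      rw [mul_comm]
      exact (isHomogeneous_entryPolynomial j i).C_mul _
  | .inr (.inl i) =>
    refine ⟨⟨1, (isHomogeneous_X _ _).map _⟩, 0, fun b => ?_⟩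
    rw [nullityEquation, coeff_map]
    exact isHomogeneous_C _ _
  | .inr (.inr (i, π)) =>
    refine ⟨⟨1, ((isHomogeneous_X _ _).sub (isHomogeneous_C_mul_X _ _)).map _⟩, 0, fun b => ?_⟩
    rw [nullityEquation, coeff_map]
    exact isHomogeneous_C _ _

theorem aeval_nullityEquation_iff {L : Type*} [Field L] [Algebra K L] {k r : ℕ}
    {Ψ : SkewForm K s n m} {y : (Fin (r + 1) → Fin n) → L} :
    (∀ x, aeval y (map (eval (coords Ψ)) (nullityEquation K s n m k r x)) = 0) ↔
      IsAlternatingTensor y ∧ ∀ (q : Fin s → (Fin r → Fin n) × Fin n) (j : Fin m),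
        (entry (extendScalars L Ψ) j fun p =>
          if (p : ℕ) < k then tensorContraction y (q p).1 else Pi.single (q p).2 1) = 0 := by
  have hmap : ∀ P : MvPolynomial (Fin (r + 1) → Fin n) K,
      map (eval (coords Ψ)) (map C P) = P := fun P => by
    rw [map_map]
    convert MvPolynomial.map_id P
    ext a
    simp
  have hvan : ∀ (q : Fin s → (Fin r → Fin n) × Fin n) (j : Fin m),
      aeval y (map (eval (coords Ψ)) (nullityEquation K s n m k r (.inl (q, j)))) =
        entry (extendScalars L Ψ) j fun p =>
          if (p : ℕ) < k then tensorContraction y (q p).1 else Pi.single (q p).2 1 := by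
    intro q j
    rw [entry_eq_sum, nullityEquation, map_sum, map_sum]
    refine Finset.sum_congr rfl fun i _ => ?_
    rw [map_mul, hmap, map_C, map_mul, mul_comm, eval_entryPolynomial, entry_extendScalars, aeval_C,
      map_prod]
    congr 1
    refine Finset.prod_congr rfl fun p _ => ?_
    rw [argumentPolynomial]
    split_ifs with hp hi
    · simp [tensorContraction]
    · simp [hi]
    · simp [hi]
  rw [Sum.forall, Sum.forall, and_comm]
  refine and_congr (and_congr ?_ ?_) ?_
  · simp [nullityEquation]
  · simp [nullityEquation, sub_eq_zero]
  · simp only [Prod.forall, hvan]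

/-- The forms whose nullity over an algebraically closed extension is at least `r` are the common
zeros of finitely many homogeneous polynomials over the base field. -/
theorem isHomogeneousAlgebraicSet_le_nullity_extendScalars (K L : Type*) [Field K] [Field L]
    [Algebra K L] [IsAlgClosed L] (s k r n m : ℕ) :
    IsHomogeneousAlgebraicSet {Ψ : SkewForm K s n m | r ≤ nullity k (extendScalars L Ψ)} := by
  cases r with
  -- The condition is void here, and a tensor of order `0` has no index to contract.
  | zero => exact ⟨∅, by simp, by simp⟩
  | succ r =>
    choose D hD using fun x => (exists_isHomogeneous_nullityEquation (K := K) (s := s) (n := n)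
      (m := m) k r x).1
    choose E hE using fun x => (exists_isHomogeneous_nullityEquation (K := K) (s := s) (n := n)
      (m := m) k r x).2
    obtain ⟨S, hS, hSF⟩ := exists_finset_isHomogeneous_forall_eval_eq_zero_iff L hD hE
    refine ⟨S, hS, fun Ψ => ?_⟩
    rw [← hSF, Set.mem_ofPred_eq, succ_le_nullity_iff_exists_tensor]
    simp only [aeval_nullityEquation_iff]

end SkewForm

theorem mainTheorem4 (s k r n m : ℕ) (hks : k ≤ s) :
    (∀ (K : Type*) [Field K] [IsAlgClosed K],
      SkewForm.IsHomogeneousAlgebraicSet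
        {Ψ : SkewForm K s n m | r ≤ SkewForm.nullity k Ψ}) ∧
    (∀ (K : Type*) [Field K] (L : Type*) [Field L] [Algebra K L] [IsAlgClosure K L],
      SkewForm.IsHomogeneousAlgebraicSet
        {Ψ : SkewForm K s n m | r ≤ SkewForm.nullity k (SkewForm.extendScalars L Ψ)}) := by
  refine ⟨fun K _ _ => ?_, fun K _ L _ _ _ => ?_⟩
  · simpa only [SkewForm.extendScalars_self] using
      SkewForm.isHomogeneousAlgebraicSet_le_nullity_extendScalars K K s k r n m
  · have := IsAlgClosure.isAlgClosed K (K := L)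
    exact SkewForm.isHomogeneousAlgebraicSet_le_nullity_extendScalars K L s k r n m
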